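/- A dyadic grid $\mathcal D$ on $\mathbb R$ is a collection of intervals such that every $I\in\mathcal D$ has length $|I|=2^k$ for some $k\in\mathbb Z$, for each $k\in\mathbb Z$ the members of length $2^k$ form a partition of $\mathbb R$, and any two members are either disjoint or one contains the other. For $I\in\mathcal D$ let $h_I=|I|^{-1/2}(\mathbf 1_{I_+}-\mathbf 1_{I_-})$ be the Haar function, where $I_+$ and $I_-$ are the right and left halves of $I$, and put $(f,h_I)=\int_{\mathbb R} f h_I\,dx$. For $s>0$ and real-valued $f\in L^2(\mathbb R)$ let \[ D^s_{\mathcal D}f=\sum_{I\in\mathcal D}|I|^{-s}(f,h_I)\,h_I ,\qquad H^s_{\mathcal D}(\mathbb R)=\{f\in L^2(\mathbb R): D^s_{\mathcal D}f\in L^2(\mathbb R)\},\qquad \|f\|_{\dot H^s_{\mathcal D}}=\|D^s_{\mathcal D}f\|_{L^2(\mathbb R)}, \] where $D^s_{\mathcal D}f\in L^2(\mathbb R)$ means that the series converges (unconditionally) in $L^2(\mathbb R)$, and let $\mathscr S_{\mathcal D}(\mathbb R)=\mathrm{span}\{h_I: I\in\mathcal D\}$. Let $0<s<\tfrac12$ and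 $q=\frac{2}{1-2s}$. Then there is a constant $C>0$, depending only on $s$, such that for every dyadic grid $\mathcal D$ on $\mathbb R$: 1. $\mathscr S_{\mathcal D}(\mathbb R)\subseteq H^s_{\mathcal D}(\mathbb R)$, and $\|f\|_{L^q(\mathbb R)}\le C\,\|f\|_{\dot H^s_{\mathcal D}}$ for every $f\in\mathscr S_{\mathcal D}(\mathbb R)$; 2. $H^s_{\mathcal D}(\mathbb R)\subseteq L^{q}(\mathbb R)$, with $\|f\|_{L^q(\mathbb R)}\le C\,\|f\|_{\dot H^s_{\mathcal D}}$ for every $f\in H^s_{\mathcal D}(\mathbb R)$. -/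

import Mathlib

open MeasureTheory
open scoped ENNReal

noncomputable section

/-- A dyadic grid on `ℝ`: a collection of intervals (open, closed or half-open) whose lengths are
integer powers of `2`, such that for each `k : ℤ` the members of length `2 ^ k` partition `ℝ`, and
any two members are disjoint or nested. -/
structure DyadicGrid where
  intervals : Set (Set ℝ)
  isInterval : ∀ I ∈ intervals, I.OrdConnected
  length_eq : ∀ I ∈ intervals, ∃ k : ℤ, volume I = ENNReal.ofReal ((2 : ℝ) ^ k)
  partition : ∀ k : ℤ,
    Setoid.IsPartition {I ∈ intervals | volume I = ENNReal.ofReal ((2 : ℝ) ^ k)}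
  nested : ∀ I ∈ intervals, ∀ J ∈ intervals, I ∩ J = ∅ ∨ I ∩ J = I ∨ I ∩ J = J

namespace DyadicGrid

/-- The midpoint of a bounded interval. -/
def midpoint (I : Set ℝ) : ℝ := (sInf I + sSup I) / 2

/-- The left half `I₋` of an interval. -/
def leftHalf (I : Set ℝ) : Set ℝ := I ∩ Set.Iio (midpoint I)

/-- The right half `I₊` of an interval. -/
def rightHalf (I : Set ℝ) : Set ℝ := I ∩ Set.Ici (midpoint I)

/-- The Haar function `h_I = |I|^{-1/2} (1_{I₊} - 1_{I₋})`. -/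
def haar (I : Set ℝ) (x : ℝ) : ℝ :=
  (1 / √(volume.real I)) *
    ((rightHalf I).indicator (fun _ => (1 : ℝ)) x - (leftHalf I).indicator (fun _ => (1 : ℝ)) x)

theorem memLp_haar (𝒟 : DyadicGrid) {I : Set ℝ} (hI : I ∈ 𝒟.intervals) :
    MemLp (haar I) 2 volume := by
  have hm : MeasurableSet I := (𝒟.isInterval I hI).measurableSet
  have hfin : volume I ≠ ∞ := by
    obtain ⟨k, hk⟩ := 𝒟.length_eq I hI
    rw [hk]
    exact ENNReal.ofReal_ne_top
  have hr : MemLp ((rightHalf I).indicator (fun _ => (1 : ℝ))) 2 volume :=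
    memLp_indicator_const 2 (hm.inter measurableSet_Ici) 1
      (Or.inr (measure_ne_top_of_subset Set.inter_subset_left hfin))
  have hl : MemLp ((leftHalf I).indicator (fun _ => (1 : ℝ))) 2 volume :=
    memLp_indicator_const 2 (hm.inter measurableSet_Iio) 1
      (Or.inr (measure_ne_top_of_subset Set.inter_subset_left hfin))
  exact (hr.sub hl).const_mul (1 / √(volume.real I))

variable (𝒟 : DyadicGrid)

/-- The Haar function `h_I`, `I ∈ 𝒟`, as an element of `L²(ℝ)`. -/
def haarL2 (I : 𝒟.intervals) : Lp ℝ 2 (volume : Measure ℝ) :=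
  (𝒟.memLp_haar I.2).toLp (haar (I : Set ℝ))

/-- The Haar span, which plays the role of the Schwartz functions. -/
def haarSpan : Submodule ℝ (Lp ℝ 2 (volume : Measure ℝ)) :=
  Submodule.span ℝ (Set.range 𝒟.haarL2)

/-- The Haar coefficient `(f, h_I) = ∫ f h_I dx`. -/
def haarCoeff (f : Lp ℝ 2 (volume : Measure ℝ)) (I : 𝒟.intervals) : ℝ :=
  ∫ x, f x * haar (I : Set ℝ) x

/-- The term `|I|^{-s} (f, h_I) h_I` of the series for the dyadic fractional derivative. -/
def fracDerivTerm (s : ℝ) (f : Lp ℝ 2 (volume : Measure ℝ)) (I : 𝒟.intervals) :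
    Lp ℝ 2 (volume : Measure ℝ) :=
  (volume.real (I : Set ℝ) ^ (-s) * 𝒟.haarCoeff f I) • 𝒟.haarL2 I

/-- The dyadic fractional derivative `D^s f = ∑_{I ∈ 𝒟} |I|^{-s} (f, h_I) h_I`, a series in `L²(ℝ)`
(meaningful when the series converges, i.e. when `f` is in `sobolev 𝒟 s`). -/
def fracDeriv (s : ℝ) (f : Lp ℝ 2 (volume : Measure ℝ)) : Lp ℝ 2 (volume : Measure ℝ) :=
  ∑' I : 𝒟.intervals, 𝒟.fracDerivTerm s f I

/-- The dyadic fractional Sobolev space `H^s`: the `f ∈ L²(ℝ)` with `D^s f ∈ L²(ℝ)`, i.e. such that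
the (orthogonal) series defining `D^s f` converges in `L²(ℝ)`. -/
def sobolev (s : ℝ) : Set (Lp ℝ 2 (volume : Measure ℝ)) :=
  {f | Summable (𝒟.fracDerivTerm s f)}

/-- The homogeneous seminorm `‖D^s f‖_{L²}`. -/
def homSeminorm (s : ℝ) (f : Lp ℝ 2 (volume : Measure ℝ)) : ℝ :=
  ‖𝒟.fracDeriv s f‖

end DyadicGrid

end

/-! Let `E_k f(x)` be the average of `f` over the grid cell of length `2 ^ k` containing `x`. It
tends to `0` as `k → +∞` (Cauchy–Schwarz, `f ∈ L²`) and, for a.e. `x`, to `f x` as `k → -∞`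
(Lebesgue differentiation). So `f x` is a telescoping sum, and by `abs_cellAverage_sub` its
increments have size `|(f, h_I)| |I|^{-1/2}`, with `I` the cell.

Put `G = ‖D^s f‖` and let `S(x)` be the dyadic square function of `D^s f`. Each increment is at most
`2^{ks} S(x)`, and also at most `2^{k(s-1/2)} G`. Using the first bound at small scales, the second
at large ones, and cutting where `2 ^ k ≈ (G / S)²`, two geometric series give the Hedberg-type
bound `|f| ≤ C S^{1-2s} G^{2s}` (`abs_le_rpow_mul_rpow_of_increments_le`, `ae_abs_le`).

Since `(1 - 2s) q = 2`, the `q`-th power of the bound contains exactly `S²`, whose integral is `G²`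
by Parseval (`lintegral_squareFunction`). The argument covers every `f` in `sobolev`; neither
density of the Haar span nor completeness of the Haar system enters. -/

/-- A set squeezed between an open interval and its closure is almost everywhere equal to it. -/
theorem ae_eq_Icc_of_Ioo_subset {a b : ℝ} {s : Set ℝ} (h₁ : Set.Ioo a b ⊆ s)
    (h₂ : s ⊆ Set.Icc a b) : s =ᵐ[volume] Set.Icc a b :=
  Filter.EventuallyLE.antisymm (LE.le.eventuallyLE h₂)
    (Ioo_ae_eq_Icc.symm.le.trans (LE.le.eventuallyLE h₁))

namespace DyadicGrid

variable (𝒟 : DyadicGrid)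

/-! ### Geometry of the grid: endpoints, halves, cells, countability. -/

section Geometry

variable {𝒟} {I J : Set ℝ}

theorem volume_ne_top (hI : I ∈ 𝒟.intervals) : volume I ≠ ∞ := by
  obtain ⟨k, hk⟩ := 𝒟.length_eq I hI
  rw [hk]
  exact ENNReal.ofReal_ne_top

theorem volume_real_eq_zpow (hI : I ∈ 𝒟.intervals) : ∃ k : ℤ, volume.real I = (2 : ℝ) ^ k := by
  obtain ⟨k, hk⟩ := 𝒟.length_eq I hI
  exact ⟨k, by rw [measureReal_def, hk, ENNReal.toReal_ofReal (by positivity)]⟩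

theorem volume_real_pos (hI : I ∈ 𝒟.intervals) : 0 < volume.real I := by
  obtain ⟨k, hk⟩ := volume_real_eq_zpow hI
  rw [hk]
  positivity

theorem measurableSet_of_mem (hI : I ∈ 𝒟.intervals) : MeasurableSet I :=
  (𝒟.isInterval I hI).measurableSet

theorem nonempty_of_mem (hI : I ∈ 𝒟.intervals) : I.Nonempty := by
  rw [Set.nonempty_iff_ne_empty]
  rintro rfl
  simpa using volume_real_pos hI

theorem sub_le_volume_real (hI : I ∈ 𝒟.intervals) {x y : ℝ} (hx : x ∈ I) (hy : y ∈ I) :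
    y - x ≤ volume.real I := by
  rcases le_total x y with h | h
  · have := measureReal_mono ((𝒟.isInterval I hI).out hx hy) (volume_ne_top hI)
    rwa [Real.volume_real_Icc_of_le h] at this
  · linarith [volume_real_pos hI]

theorem bddAbove_of_mem (hI : I ∈ 𝒟.intervals) : BddAbove I := by
  obtain ⟨x, hx⟩ := nonempty_of_mem hI
  exact ⟨x + volume.real I, fun y hy => by linarith [sub_le_volume_real hI hx hy]⟩

theorem bddBelow_of_mem (hI : I ∈ 𝒟.intervals) : BddBelow I := by
  obtain ⟨x, hx⟩ := nonempty_of_mem hI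
  exact ⟨x - volume.real I, fun y hy => by linarith [sub_le_volume_real hI hy hx]⟩

theorem Ioo_subset_of_mem (hI : I ∈ 𝒟.intervals) : Set.Ioo (sInf I) (sSup I) ⊆ I :=
  IsConnected.Ioo_csInf_csSup_subset
    ⟨nonempty_of_mem hI, isPreconnected_iff_ordConnected.2 (𝒟.isInterval I hI)⟩
    (bddBelow_of_mem hI) (bddAbove_of_mem hI)

theorem subset_Icc_of_mem (hI : I ∈ 𝒟.intervals) : I ⊆ Set.Icc (sInf I) (sSup I) :=
  subset_Icc_csInf_csSup (bddBelow_of_mem hI) (bddAbove_of_mem hI)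

theorem ae_eq_Icc_of_mem (hI : I ∈ 𝒟.intervals) :
    I =ᵐ[volume] Set.Icc (sInf I) (sSup I) :=
  ae_eq_Icc_of_Ioo_subset (Ioo_subset_of_mem hI) (subset_Icc_of_mem hI)

theorem volume_real_eq_sub (hI : I ∈ 𝒟.intervals) : volume.real I = sSup I - sInf I := by
  rw [measureReal_congr (ae_eq_Icc_of_mem hI), Real.volume_real_Icc_of_le]
  obtain ⟨x, hx⟩ := nonempty_of_mem hI
  exact (csInf_le (bddBelow_of_mem hI) hx).trans (le_csSup (bddAbove_of_mem hI) hx)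

theorem sInf_lt_sSup (hI : I ∈ 𝒟.intervals) : sInf I < sSup I := by
  linarith [volume_real_pos hI, volume_real_eq_sub hI]

theorem leftHalf_ae_eq (hI : I ∈ 𝒟.intervals) :
    leftHalf I =ᵐ[volume] Set.Icc (sInf I) (midpoint I) := by
  refine ae_eq_Icc_of_Ioo_subset (fun x hx => ⟨Ioo_subset_of_mem hI ⟨hx.1, ?_⟩, hx.2⟩)
    fun x hx => ⟨(subset_Icc_of_mem hI hx.1).1, le_of_lt hx.2⟩
  have := hx.2
  have := sInf_lt_sSup hI
  rw [midpoint] at *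
  linarith

theorem rightHalf_ae_eq (hI : I ∈ 𝒟.intervals) :
    rightHalf I =ᵐ[volume] Set.Icc (midpoint I) (sSup I) := by
  refine ae_eq_Icc_of_Ioo_subset (fun x hx => ⟨Ioo_subset_of_mem hI ⟨?_, hx.2⟩, le_of_lt hx.1⟩)
    fun x hx => ⟨hx.2, (subset_Icc_of_mem hI hx.1).2⟩
  have := hx.1
  have := sInf_lt_sSup hI
  rw [midpoint] at *
  linarith

theorem volume_real_leftHalf (hI : I ∈ 𝒟.intervals) :
    volume.real (leftHalf I) = volume.real I / 2 := by
  have := sInf_lt_sSup hI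
  rw [measureReal_congr (leftHalf_ae_eq hI), volume_real_eq_sub hI, Real.volume_real_Icc_of_le]
  all_goals rw [midpoint]; linarith

theorem volume_real_rightHalf (hI : I ∈ 𝒟.intervals) :
    volume.real (rightHalf I) = volume.real I / 2 := by
  have := sInf_lt_sSup hI
  rw [measureReal_congr (rightHalf_ae_eq hI), volume_real_eq_sub hI, Real.volume_real_Icc_of_le]
  all_goals rw [midpoint]; linarith

theorem disjoint_halves : Disjoint (rightHalf I) (leftHalf I) :=
  Set.disjoint_left.2 fun _ hr hl => (Set.mem_Ici.1 hr.2).not_gt hl.2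

theorem halves_union : rightHalf I ∪ leftHalf I = I := by
  rw [rightHalf, leftHalf, ← Set.inter_union_distrib_left, Set.Ici_union_Iio, Set.inter_univ]

theorem measurableSet_leftHalf (hI : I ∈ 𝒟.intervals) : MeasurableSet (leftHalf I) :=
  (measurableSet_of_mem hI).inter measurableSet_Iio

theorem measurableSet_rightHalf (hI : I ∈ 𝒟.intervals) : MeasurableSet (rightHalf I) :=
  (measurableSet_of_mem hI).inter measurableSet_Ici

theorem eq_of_mem_of_volume_eq (hI : I ∈ 𝒟.intervals) (hJ : J ∈ 𝒟.intervals)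
    (h : volume.real J = volume.real I) {x : ℝ} (hxI : x ∈ I) (hxJ : x ∈ J) : J = I := by
  obtain ⟨k, hk⟩ := 𝒟.length_eq I hI
  have hJk : volume J = ENNReal.ofReal ((2 : ℝ) ^ k) := by
    rw [← hk]
    exact (ENNReal.toReal_eq_toReal_iff' (volume_ne_top hJ) (volume_ne_top hI)).1 h
  exact ((𝒟.partition k).2 x).unique ⟨⟨hJ, hJk⟩, hxJ⟩ ⟨⟨hI, hk⟩, hxI⟩

theorem subset_of_mem_of_volume_le (hI : I ∈ 𝒟.intervals) (hJ : J ∈ 𝒟.intervals)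
    (h : volume.real J ≤ volume.real I) {x : ℝ} (hxI : x ∈ I) (hxJ : x ∈ J) : J ⊆ I := by
  rcases h.eq_or_lt with h | h
  · exact (eq_of_mem_of_volume_eq hI hJ h hxI hxJ).le
  rcases 𝒟.nested I hI J hJ with h' | h' | h'
  · exact absurd (show x ∈ I ∩ J from ⟨hxI, hxJ⟩) (by simp [h'])
  · exact absurd (measureReal_mono (Set.inter_eq_left.1 h') (volume_ne_top hJ)) (not_le.2 h)
  · exact Set.inter_eq_right.1 h'

variable (𝒟) in
/-- The member of the grid of length `2 ^ k` which contains `x`. -/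
noncomputable def cell (k : ℤ) (x : ℝ) : Set ℝ := ((𝒟.partition k).2 x).choose

theorem cell_spec (k : ℤ) (x : ℝ) :
    (𝒟.cell k x ∈ 𝒟.intervals ∧ volume (𝒟.cell k x) = ENNReal.ofReal ((2 : ℝ) ^ k)) ∧
      x ∈ 𝒟.cell k x :=
  ((𝒟.partition k).2 x).choose_spec.1

theorem cell_mem (k : ℤ) (x : ℝ) : 𝒟.cell k x ∈ 𝒟.intervals := (cell_spec k x).1.1

theorem mem_cell (k : ℤ) (x : ℝ) : x ∈ 𝒟.cell k x := (cell_spec k x).2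

theorem volume_real_cell (k : ℤ) (x : ℝ) : volume.real (𝒟.cell k x) = (2 : ℝ) ^ k := by
  rw [measureReal_def, (cell_spec k x).1.2, ENNReal.toReal_ofReal (by positivity)]

theorem sSup_le_of_disjoint (hI : I ∈ 𝒟.intervals) (hJ : J ∈ 𝒟.intervals) (h : Disjoint I J)
    {x y : ℝ} (hx : x ∈ I) (hy : y ∈ J) (hxy : x ≤ y) : sSup I ≤ sInf J := by
  refine csSup_le (nonempty_of_mem hI) fun u hu => le_csInf (nonempty_of_mem hJ) fun v hv => ?_
  by_contra! hvu
  rw [Set.disjoint_left] at h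
  rcases le_total v x with hvx | hvx
  · exact h hx ((𝒟.isInterval J hJ).out hv hy ⟨hvx, hxy⟩)
  · exact h ((𝒟.isInterval I hI).out hx hu ⟨hvx, hvu.le⟩) hv

/-- A member of half the length of `I` inside `I` is one of the two halves of `I`. -/
theorem endpoints_of_volume_eq_half (hI : I ∈ 𝒟.intervals) (hJ : J ∈ 𝒟.intervals) (hJI : J ⊆ I)
    (h : volume.real J = volume.real I / 2) :
    (sInf J = sInf I ∧ sSup J = midpoint I) ∨ (sInf J = midpoint I ∧ sSup J = sSup I) := by
  -- The cell `K` of length `|J|` around a point of `I \ J` is disjoint from `J`. Their lengths add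
  -- up to `|I|`, so together they leave no room in `I`, and the endpoints follow by linear
  -- arithmetic.
  obtain ⟨y, hyI, hyJ⟩ : ∃ y ∈ I, y ∉ J := by
    by_contra! hcon
    have : J = I := hJI.antisymm hcon
    rw [this] at h
    linarith [volume_real_pos hI]
  obtain ⟨k, hk⟩ := volume_real_eq_zpow hJ
  set K := 𝒟.cell k y with hKdef
  have hK : K ∈ 𝒟.intervals := cell_mem k y
  have hyK : y ∈ K := mem_cell k y
  have hKvol : volume.real K = volume.real J := by rw [hk, hKdef, volume_real_cell]
  have hKI : K ⊆ I := subset_of_mem_of_volume_le hI hK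
    (by linarith [volume_real_pos hI]) hyI hyK
  have hdisj : Disjoint J K := by
    rw [Set.disjoint_left]
    intro z hzJ hzK
    exact hyJ (eq_of_mem_of_volume_eq hJ hK hKvol hzJ hzK ▸ hyK)
  obtain ⟨x, hx⟩ := nonempty_of_mem hJ
  have e1 := volume_real_eq_sub hI
  have e2 := volume_real_eq_sub hJ
  have e3 := volume_real_eq_sub hK
  have b1 := csInf_le_csInf (bddBelow_of_mem hI) (nonempty_of_mem hJ) hJI
  have b2 := csInf_le_csInf (bddBelow_of_mem hI) (nonempty_of_mem hK) hKI
  have b3 := csSup_le_csSup (bddAbove_of_mem hI) (nonempty_of_mem hJ) hJI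
  have b4 := csSup_le_csSup (bddAbove_of_mem hI) (nonempty_of_mem hK) hKI
  rw [midpoint]
  rcases le_total x y with hxy | hxy
  · have := sSup_le_of_disjoint hJ hK hdisj hx hyK hxy
    left; constructor <;> linarith
  · have := sSup_le_of_disjoint hK hJ hdisj.symm hyK hx hxy
    right; constructor <;> linarith

/-- Only almost everywhere: either child in the grid may own the midpoint of `I`, whereas
`rightHalf` always takes it. -/
theorem ae_eq_half_of_volume_eq_half (hI : I ∈ 𝒟.intervals) (hJ : J ∈ 𝒟.intervals) (hJI : J ⊆ I)
    (h : volume.real J = volume.real I / 2) :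
    J =ᵐ[volume] leftHalf I ∨ J =ᵐ[volume] rightHalf I := by
  rcases endpoints_of_volume_eq_half hI hJ hJI h with ⟨h1, h2⟩ | ⟨h1, h2⟩
  · left
    have := ae_eq_Icc_of_mem hJ
    rw [h1, h2] at this
    exact this.trans (leftHalf_ae_eq hI).symm
  · right
    have := ae_eq_Icc_of_mem hJ
    rw [h1, h2] at this
    exact this.trans (rightHalf_ae_eq hI).symm

theorem cell_subset_cell {j k : ℤ} (h : j ≤ k) (x : ℝ) : 𝒟.cell j x ⊆ 𝒟.cell k x := by
  refine subset_of_mem_of_volume_le (cell_mem k x) (cell_mem j x) ?_ (mem_cell k x) (mem_cell j x)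
  rw [volume_real_cell, volume_real_cell]
  exact zpow_le_zpow_right₀ (by norm_num) h

theorem cell_ae_eq_half (k : ℤ) (x : ℝ) :
    𝒟.cell (k - 1) x =ᵐ[volume] leftHalf (𝒟.cell k x) ∨
      𝒟.cell (k - 1) x =ᵐ[volume] rightHalf (𝒟.cell k x) := by
  refine ae_eq_half_of_volume_eq_half (cell_mem k x) (cell_mem _ x)
    (cell_subset_cell (by omega) x) ?_
  rw [volume_real_cell, volume_real_cell, zpow_sub_one₀ two_ne_zero, div_eq_mul_inv]

variable (𝒟) in
theorem countable_intervals : 𝒟.intervals.Countable := by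
  have h : 𝒟.intervals ⊆
      ⋃ k : ℤ, {I ∈ 𝒟.intervals | volume I = ENNReal.ofReal ((2 : ℝ) ^ k)} := fun I hI => by
    obtain ⟨k, hk⟩ := 𝒟.length_eq I hI
    exact Set.mem_iUnion.2 ⟨k, hI, hk⟩
  refine (Set.countable_iUnion fun k => ?_).mono h
  refine Set.PairwiseDisjoint.countable_of_nonempty_interior (s := id)
    (𝒟.partition k).pairwiseDisjoint fun I hI => ?_
  have hsub : Set.Ioo (sInf I) (sSup I) ⊆ interior I :=
    interior_maximal (Ioo_subset_of_mem hI.1) isOpen_Ioo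
  exact (Set.nonempty_Ioo.2 (sInf_lt_sSup hI.1)).mono hsub

end Geometry

end DyadicGrid

namespace DyadicGrid

variable (𝒟 : DyadicGrid)

/-! ### Haar functions: orthonormality and Parseval. -/

section Haar

variable {𝒟} {I J : Set ℝ}

theorem haar_of_notMem {x : ℝ} (hx : x ∉ I) : haar I x = 0 := by
  have h1 : x ∉ rightHalf I := fun h => hx h.1
  have h2 : x ∉ leftHalf I := fun h => hx h.1
  simp [haar, h1, h2]

theorem haar_of_mem_rightHalf {x : ℝ} (hx : x ∈ rightHalf I) :
    haar I x = 1 / √(volume.real I) := by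
  simp [haar, hx, Set.disjoint_left.1 disjoint_halves hx]

theorem haar_of_mem_leftHalf {x : ℝ} (hx : x ∈ leftHalf I) :
    haar I x = -(1 / √(volume.real I)) := by
  simp [haar, hx, Set.disjoint_right.1 disjoint_halves hx]

theorem integral_mul_haar (hI : I ∈ 𝒟.intervals) {g : ℝ → ℝ} (hg : IntegrableOn g I) :
    ∫ x, g x * haar I x =
      1 / √(volume.real I) * ((∫ x in rightHalf I, g x) - ∫ x in leftHalf I, g x) := by
  have h : (fun x => g x * haar I x) = fun x => 1 / √(volume.real I) *
      ((rightHalf I).indicator g x - (leftHalf I).indicator g x) := by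
    funext x
    have h1 (A : Set ℝ) : A.indicator g x = g x * A.indicator (fun _ => 1) x := by
      by_cases hx : x ∈ A <;> simp [hx]
    rw [haar, h1, h1]
    ring
  rw [h, integral_const_mul, integral_sub, integral_indicator (measurableSet_rightHalf hI),
    integral_indicator (measurableSet_leftHalf hI)]
  · exact (hg.mono_set Set.inter_subset_left).integrable_indicator (measurableSet_rightHalf hI)
  · exact (hg.mono_set Set.inter_subset_left).integrable_indicator (measurableSet_leftHalf hI)

theorem integral_haar (hI : I ∈ 𝒟.intervals) : ∫ x, haar I x = 0 := by
  have h := integral_mul_haar hI (g := fun _ => 1) (by simp [volume_ne_top hI, lt_top_iff_ne_top])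
  simpa [volume_real_leftHalf hI, volume_real_rightHalf hI] using h

theorem integral_haar_mul_self (hI : I ∈ 𝒟.intervals) : ∫ x, haar I x * haar I x = 1 := by
  have hpos := volume_real_pos hI
  have hsq := Real.mul_self_sqrt hpos.le
  have h : (fun x => haar I x * haar I x) = I.indicator fun _ => (volume.real I)⁻¹ := by
    funext x
    by_cases hx : x ∈ I
    · rw [Set.indicator_of_mem hx]
      rw [← halves_union (I := I)] at hx
      rcases hx with hx | hx
      · rw [haar_of_mem_rightHalf hx, ← hsq]
        field_simp
        simp
      · rw [haar_of_mem_leftHalf hx, ← hsq]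
        field_simp
        simp
    · simp [haar_of_notMem hx, hx]
  rw [h, integral_indicator (measurableSet_of_mem hI), setIntegral_const, smul_eq_mul]
  exact mul_inv_cancel₀ (ne_of_gt hpos)

/-- On a strictly smaller member of the grid, `h_I` is almost everywhere constant. -/
theorem exists_haar_ae_eq_const (hI : I ∈ 𝒟.intervals) (hJ : J ∈ 𝒟.intervals)
    (h : volume.real J < volume.real I) : ∃ c : ℝ, ∀ᵐ x, x ∈ J → haar I x = c := by
  obtain ⟨x, hxJ⟩ := nonempty_of_mem hJ
  by_cases hxI : x ∈ I
  · obtain ⟨k, hk⟩ := volume_real_eq_zpow hI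
    obtain ⟨j, hj⟩ := volume_real_eq_zpow hJ
    have hjk : j < k := by
      rw [hj, hk] at h
      exact (zpow_lt_zpow_iff_right₀ (by norm_num)).1 h
    have hIc : I = 𝒟.cell k x := eq_of_mem_of_volume_eq (cell_mem k x) hI
      (by rw [hk, volume_real_cell]) (mem_cell k x) hxI
    have hJc : J = 𝒟.cell j x := eq_of_mem_of_volume_eq (cell_mem j x) hJ
      (by rw [hj, volume_real_cell]) (mem_cell j x) hxJ
    -- Lengths are powers of `2`, so a strictly shorter cell already lies in the child of `I` around
    -- `x`, which is a.e. a half of `I`.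
    have hsub : J ⊆ 𝒟.cell (k - 1) x := hJc ▸ cell_subset_cell (by omega) x
    have hhalf := cell_ae_eq_half (𝒟 := 𝒟) k x
    rw [← hIc] at hhalf
    rcases hhalf with hhalf | hhalf
    · refine ⟨-(1 / √(volume.real I)), ?_⟩
      filter_upwards [hhalf.mem_iff] with y hy hyJ
      exact haar_of_mem_leftHalf (hy.1 (hsub hyJ))
    · refine ⟨1 / √(volume.real I), ?_⟩
      filter_upwards [hhalf.mem_iff] with y hy hyJ
      exact haar_of_mem_rightHalf (hy.1 (hsub hyJ))
  · refine ⟨0, Filter.Eventually.of_forall fun y hyJ => haar_of_notMem fun hyI => ?_⟩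
    exact hxI (subset_of_mem_of_volume_le hI hJ h.le hyI hyJ hxJ)

theorem integral_haar_mul_of_volume_lt (hI : I ∈ 𝒟.intervals) (hJ : J ∈ 𝒟.intervals)
    (h : volume.real J < volume.real I) : ∫ x, haar I x * haar J x = 0 := by
  obtain ⟨c, hc⟩ := exists_haar_ae_eq_const hI hJ h
  have : (fun x => haar I x * haar J x) =ᵐ[volume] fun x => c * haar J x := by
    filter_upwards [hc] with x hx
    by_cases hxJ : x ∈ J
    · rw [hx hxJ]
    · simp [haar_of_notMem hxJ]
  rw [integral_congr_ae this, integral_const_mul, integral_haar hJ, mul_zero]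

theorem integral_haar_mul_of_ne (hI : I ∈ 𝒟.intervals) (hJ : J ∈ 𝒟.intervals) (h : I ≠ J) :
    ∫ x, haar I x * haar J x = 0 := by
  rcases lt_trichotomy (volume.real I) (volume.real J) with hlt | heq | hlt
  · simp_rw [mul_comm (haar I _)]
    exact integral_haar_mul_of_volume_lt hJ hI hlt
  · have : (fun x => haar I x * haar J x) = fun _ => 0 := by
      funext x
      by_cases hxI : x ∈ I
      · have hxJ : x ∉ J := fun hxJ => h (eq_of_mem_of_volume_eq hJ hI heq hxJ hxI)
        simp [haar_of_notMem hxJ]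
      · simp [haar_of_notMem hxI]
    simp [this]
  · exact integral_haar_mul_of_volume_lt hI hJ hlt

end Haar

theorem inner_haarL2 (f : Lp ℝ 2 (volume : Measure ℝ)) (I : 𝒟.intervals) :
    inner ℝ (𝒟.haarL2 I) f = 𝒟.haarCoeff f I := by
  rw [L2.inner_def, haarCoeff]
  refine integral_congr_ae ?_
  filter_upwards [(𝒟.memLp_haar I.2).coeFn_toLp] with x hx
  rw [haarL2, hx]
  simp

theorem haarCoeff_haarL2 (I J : 𝒟.intervals) :
    𝒟.haarCoeff (𝒟.haarL2 J) I = ∫ x, haar (J : Set ℝ) x * haar (I : Set ℝ) x := by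
  refine integral_congr_ae ?_
  filter_upwards [(𝒟.memLp_haar J.2).coeFn_toLp] with x hx
  rw [haarL2, hx]

theorem orthonormal_haarL2 : Orthonormal ℝ 𝒟.haarL2 := by
  refine ⟨fun I => ?_, fun I J h => ?_⟩
  · rw [norm_eq_sqrt_real_inner, inner_haarL2, haarCoeff_haarL2, integral_haar_mul_self I.2,
      Real.sqrt_one]
  · change inner ℝ (𝒟.haarL2 I) (𝒟.haarL2 J) = 0
    rw [inner_haarL2, haarCoeff_haarL2]
    exact integral_haar_mul_of_ne J.2 I.2 fun e => h (Subtype.ext e.symm)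

theorem haarCoeff_add (f g : Lp ℝ 2 (volume : Measure ℝ)) (I : 𝒟.intervals) :
    𝒟.haarCoeff (f + g) I = 𝒟.haarCoeff f I + 𝒟.haarCoeff g I := by
  simp_rw [← inner_haarL2, inner_add_right]

theorem haarCoeff_smul (c : ℝ) (f : Lp ℝ 2 (volume : Measure ℝ)) (I : 𝒟.intervals) :
    𝒟.haarCoeff (c • f) I = c * 𝒟.haarCoeff f I := by
  simp_rw [← inner_haarL2, inner_smul_right]

theorem fracDerivTerm_add (s : ℝ) (f g : Lp ℝ 2 (volume : Measure ℝ)) :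
    𝒟.fracDerivTerm s (f + g) = 𝒟.fracDerivTerm s f + 𝒟.fracDerivTerm s g := by
  funext I
  simp only [fracDerivTerm, Pi.add_apply, haarCoeff_add, mul_add, add_smul]

theorem fracDerivTerm_smul (s c : ℝ) (f : Lp ℝ 2 (volume : Measure ℝ)) :
    𝒟.fracDerivTerm s (c • f) = c • 𝒟.fracDerivTerm s f := by
  funext I
  simp only [fracDerivTerm, Pi.smul_apply, haarCoeff_smul, smul_smul]
  ring_nf

theorem haarSpan_subset_sobolev (s : ℝ) {f : Lp ℝ 2 (volume : Measure ℝ)}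
    (hf : f ∈ 𝒟.haarSpan) : f ∈ 𝒟.sobolev s := by
  induction hf using Submodule.span_induction with
  | mem f hf =>
    obtain ⟨J, rfl⟩ := hf
    refine summable_of_ne_finset_zero (s := {J}) fun I hI => ?_
    rw [fracDerivTerm, ← inner_haarL2,
      𝒟.orthonormal_haarL2.inner_eq_zero (Finset.notMem_singleton.1 hI), mul_zero, zero_smul]
  | zero =>
    have := 𝒟.fracDerivTerm_smul s 0 0
    rw [zero_smul, zero_smul] at this
    change Summable _
    rw [this]
    exact summable_zero
  | add f g _ _ hf hg =>
    change Summable _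
    rw [fracDerivTerm_add]
    exact Summable.add hf hg
  | smul c f _ hf =>
    change Summable _
    rw [fracDerivTerm_smul]
    exact Summable.const_smul c hf

/-- The Parseval identity for `D^s f`. -/
theorem hasSum_sq_homSeminorm {s : ℝ} {f : Lp ℝ 2 (volume : Measure ℝ)} (hf : f ∈ 𝒟.sobolev s) :
    HasSum (fun I : 𝒟.intervals => (volume.real (I : Set ℝ) ^ (-s) * 𝒟.haarCoeff f I) ^ 2)
      (𝒟.homSeminorm s f ^ 2) := by
  have hsum : HasSum (𝒟.fracDerivTerm s f) (𝒟.fracDeriv s f) := Summable.hasSum hf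
  -- Pairing the convergent series with `h_I` isolates one coefficient; pairing it with its own sum
  -- then gives the sum of squares.
  have hcoeff : ∀ I : 𝒟.intervals, inner ℝ (𝒟.haarL2 I) (𝒟.fracDeriv s f) =
      volume.real (I : Set ℝ) ^ (-s) * 𝒟.haarCoeff f I := fun I => by
    have h1 := hsum.mapL (innerSL ℝ (𝒟.haarL2 I))
    refine h1.unique ?_
    convert hasSum_single I fun J hJ => ?_ using 1
    · simp [fracDerivTerm, 𝒟.orthonormal_haarL2.norm_eq_one]
    · simp [fracDerivTerm, 𝒟.orthonormal_haarL2.inner_eq_zero hJ.symm]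
  have h2 := hsum.mapL (innerSL ℝ (𝒟.fracDeriv s f))
  rw [homSeminorm, ← real_inner_self_eq_norm_sq]
  refine HasSum.congr_fun h2 fun I => ?_
  rw [innerSL_apply_apply, fracDerivTerm, inner_smul_right, real_inner_comm, hcoeff, sq]

end DyadicGrid

/-! ### Real-variable core: splitting a telescoping sum. -/

/-- If the increments of `a : ℤ → ℝ` are dominated by `2 ^ (k s) S` and by `2 ^ (k (s - 1/2)) G`,
then splitting the telescoping sum at any level `N` bounds the limit at `-∞`. -/
theorem abs_le_of_increments_le {s S G y : ℝ} (hs0 : 0 < s) (hs1 : s < 1 / 2) {a : ℤ → ℝ}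
    (hS : ∀ k : ℤ, |a (k - 1) - a k| ≤ (2 : ℝ) ^ (k * s) * S)
    (hG : ∀ k : ℤ, |a (k - 1) - a k| ≤ (2 : ℝ) ^ (k * (s - 1 / 2)) * G)
    (htop : Filter.Tendsto a Filter.atTop (nhds 0))
    (hbot : Filter.Tendsto a Filter.atBot (nhds y)) (N : ℤ) :
    |y| ≤ (2 : ℝ) ^ (N * s) * S / (1 - 2 ^ (-s)) +
      (2 : ℝ) ^ ((N + 1) * (s - 1 / 2)) * G / (1 - 2 ^ (s - 1 / 2)) := by
  -- Levels above `N`: the first increment joins `N` to `N + 1` and is the one indexed `k = N + 1`,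
  -- hence the shift in the exponent.
  have hup := dist_le_of_le_geometric_of_tendsto₀ ((2 : ℝ) ^ (s - 1 / 2))
    ((2 : ℝ) ^ ((N + 1) * (s - 1 / 2)) * G) (f := fun n : ℕ => a (N + n))
    (Real.rpow_lt_one_of_one_lt_of_neg (by norm_num) (by linarith)) (fun n => by
      have := hG (N + n + 1)
      rw [add_sub_cancel_right] at this
      rw [Real.dist_eq]
      push_cast at this ⊢
      rw [← add_assoc]
      refine this.trans (le_of_eq ?_)
      rw [← Real.rpow_natCast, ← Real.rpow_mul (by norm_num), mul_right_comm,
        ← Real.rpow_add (by norm_num)]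
      ring_nf)
    (htop.comp (Filter.tendsto_atTop_add_const_left _ N tendsto_natCast_atTop_atTop))
  -- Levels below `N`: here the first increment is the one indexed `k = N`.
  have hdown := dist_le_of_le_geometric_of_tendsto₀ ((2 : ℝ) ^ (-s))
    ((2 : ℝ) ^ (N * s) * S) (f := fun n : ℕ => a (N - n))
    (Real.rpow_lt_one_of_one_lt_of_neg (by norm_num) (by linarith)) (fun n => by
      have := hS (N - n)
      rw [dist_comm, Real.dist_eq]
      push_cast at this ⊢
      rw [← sub_sub]
      refine this.trans (le_of_eq ?_)
      rw [← Real.rpow_natCast, ← Real.rpow_mul (by norm_num), mul_right_comm,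
        ← Real.rpow_add (by norm_num)]
      ring_nf)
    (hbot.comp (by
      simp_rw [sub_eq_add_neg]
      exact Filter.tendsto_atBot_add_const_left _ N
        (Filter.tendsto_neg_atTop_atBot.comp tendsto_natCast_atTop_atTop)))
  simp only [Nat.cast_zero, add_zero, sub_zero, Real.dist_eq] at hup hdown
  calc |y| = |a N - (a N - y)| := by ring_nf
    _ ≤ |a N| + |a N - y| := abs_sub _ _
    _ ≤ _ := by linarith

/-- The constant in the dyadic Sobolev inequality. -/
noncomputable def dyadicSobolevConst (s : ℝ) : ℝ :=
  1 / (1 - 2 ^ (-s)) + 1 / (1 - 2 ^ (s - 1 / 2))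

theorem dyadicSobolevConst_pos {s : ℝ} (hs0 : 0 < s) (hs1 : s < 1 / 2) :
    0 < dyadicSobolevConst s := by
  have h1 : (2 : ℝ) ^ (-s) < 1 := Real.rpow_lt_one_of_one_lt_of_neg (by norm_num) (by linarith)
  have h2 : (2 : ℝ) ^ (s - 1 / 2) < 1 :=
    Real.rpow_lt_one_of_one_lt_of_neg (by norm_num) (by linarith)
  exact add_pos (one_div_pos.2 (sub_pos.2 h1)) (one_div_pos.2 (sub_pos.2 h2))

/-- The optimal choice of the splitting level gives a Hedberg-type interpolation bound. -/
theorem abs_le_rpow_mul_rpow_of_increments_le {s S G y : ℝ} (hs0 : 0 < s) (hs1 : s < 1 / 2)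
    (hS0 : 0 ≤ S) (hG0 : 0 ≤ G) {a : ℤ → ℝ}
    (hS : ∀ k : ℤ, |a (k - 1) - a k| ≤ (2 : ℝ) ^ (k * s) * S)
    (hG : ∀ k : ℤ, |a (k - 1) - a k| ≤ (2 : ℝ) ^ (k * (s - 1 / 2)) * G)
    (htop : Filter.Tendsto a Filter.atTop (nhds 0))
    (hbot : Filter.Tendsto a Filter.atBot (nhds y)) :
    |y| ≤ dyadicSobolevConst s * (S ^ (1 - 2 * s) * G ^ (2 * s)) := by
  -- If either bound vanishes the ratio `G / S` gives no cutoff, but then all increments vanish and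
  -- so does the limit.
  by_cases h0 : S = 0 ∨ G = 0
  · have hz : ∀ k : ℤ, |a (k - 1) - a k| ≤ 0 := by
      rcases h0 with rfl | rfl
      · simpa using hS
      · simpa using hG
    have := abs_le_of_increments_le (S := 0) (G := 0) hs0 hs1 (by simpa using hz)
      (by simpa using hz) htop hbot 0
    simp only [mul_zero, zero_div, add_zero] at this
    refine this.trans ?_
    have := dyadicSobolevConst_pos hs0 hs1
    positivity
  push Not at h0
  have hSp : 0 < S := lt_of_le_of_ne hS0 h0.1.symm
  have hGp : 0 < G := lt_of_le_of_ne hG0 h0.2.symm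
  have hr : 0 < G / S := div_pos hGp hSp
  -- `2 ^ N ≤ (G / S)² < 2 ^ (N + 1)`: the scale at which the two bounds balance.
  obtain ⟨N, hN1, hN2⟩ := exists_mem_Ico_zpow (x := (G / S) ^ (2 : ℝ)) (y := (2 : ℝ))
    (by positivity) (by norm_num)
  have key := abs_le_of_increments_le hs0 hs1 hS hG htop hbot N
  have h1 : (2 : ℝ) ^ (N * s) * S ≤ S ^ (1 - 2 * s) * G ^ (2 * s) := by
    have : (2 : ℝ) ^ (N * s) ≤ (G / S) ^ (2 * s) := by
      rw [Real.rpow_mul (by norm_num), Real.rpow_mul hr.le, Real.rpow_intCast]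
      exact Real.rpow_le_rpow (by positivity) hN1 hs0.le
    calc (2 : ℝ) ^ (N * s) * S ≤ (G / S) ^ (2 * s) * S := by gcongr
      _ = _ := by
        rw [Real.div_rpow hGp.le hSp.le, Real.rpow_sub hSp, Real.rpow_one]
        ring
  have h2 : (2 : ℝ) ^ ((N + 1) * (s - 1 / 2)) * G ≤ S ^ (1 - 2 * s) * G ^ (2 * s) := by
    -- The exponent `s - 1/2` is negative, so the upper bound `(G / S)² < 2 ^ (N + 1)` is the one
    -- needed; the shift to `N + 1` makes it fit without loss.
    have : (2 : ℝ) ^ ((N + 1) * (s - 1 / 2)) ≤ (G / S) ^ (2 * (s - 1 / 2)) := by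
      rw [Real.rpow_mul (by norm_num), Real.rpow_mul hr.le]
      refine Real.rpow_le_rpow_of_nonpos (by positivity) ?_ (by linarith)
      have := hN2.le
      rw [← Real.rpow_intCast] at this
      exact_mod_cast this
    calc (2 : ℝ) ^ ((N + 1) * (s - 1 / 2)) * G ≤ (G / S) ^ (2 * (s - 1 / 2)) * G := by gcongr
      _ = _ := by
        rw [show 2 * (s - 1 / 2) = 2 * s - 1 by ring, Real.div_rpow hGp.le hSp.le,
          Real.rpow_sub hGp, show (1 - 2 * s) = -(2 * s - 1) by ring, Real.rpow_neg hSp.le,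
          Real.rpow_one]
        field_simp
  have d1 : (2 : ℝ) ^ (-s) < 1 := Real.rpow_lt_one_of_one_lt_of_neg (by norm_num) (by linarith)
  have d2 : (2 : ℝ) ^ (s - 1 / 2) < 1 :=
    Real.rpow_lt_one_of_one_lt_of_neg (by norm_num) (by linarith)
  refine key.trans ?_
  rw [dyadicSobolevConst, add_mul (1 / (1 - (2 : ℝ) ^ (-s))), one_div_mul_eq_div,
    one_div_mul_eq_div]
  exact add_le_add (div_le_div_of_nonneg_right h1 (sub_pos.2 d1).le)
    (div_le_div_of_nonneg_right h2 (sub_pos.2 d2).le)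

theorem tendsto_zpow_atBot_zero_of_one_lt {b : ℝ} (hb : 1 < b) :
    Filter.Tendsto (fun k : ℤ => b ^ k) Filter.atBot (nhds 0) := by
  have h := (tendsto_rpow_atBot_of_base_gt_one b hb).comp
    (tendsto_intCast_atBot_iff.2 (Filter.tendsto_id (α := ℤ)))
  exact h.congr fun k => Real.rpow_intCast b k

/-! ### Averages over cells and their limits. -/

namespace DyadicGrid

variable (𝒟 : DyadicGrid)

/-- The average of `f` over the member of length `2 ^ k` which contains `x`. -/
noncomputable def cellAverage (f : Lp ℝ 2 (volume : Measure ℝ)) (k : ℤ) (x : ℝ) : ℝ :=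
  ⨍ y in 𝒟.cell k x, f y

theorem cellAverage_eq (f : Lp ℝ 2 (volume : Measure ℝ)) (k : ℤ) (x : ℝ) :
    𝒟.cellAverage f k x = ((2 : ℝ) ^ k)⁻¹ * ∫ y in 𝒟.cell k x, f y := by
  rw [cellAverage, setAverage_eq, volume_real_cell, smul_eq_mul]

theorem integrableOn_of_mem {I : Set ℝ} (hI : I ∈ 𝒟.intervals)
    (f : Lp ℝ 2 (volume : Measure ℝ)) : IntegrableOn f I :=
  integrableOn_Lp_of_measure_ne_top f one_le_two (volume_ne_top hI)

/-- The martingale difference of `f` at `x` has the size of the Haar term. -/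
theorem abs_cellAverage_sub (f : Lp ℝ 2 (volume : Measure ℝ)) (k : ℤ) (x : ℝ) :
    |𝒟.cellAverage f (k - 1) x - 𝒟.cellAverage f k x| =
      |𝒟.haarCoeff f ⟨𝒟.cell k x, cell_mem k x⟩| / √((2 : ℝ) ^ k) := by
  have hI : 𝒟.cell k x ∈ 𝒟.intervals := cell_mem k x
  have hint := 𝒟.integrableOn_of_mem hI f
  have hpos : (0 : ℝ) < 2 ^ k := by positivity
  have hcoeff : 𝒟.haarCoeff f ⟨𝒟.cell k x, cell_mem k x⟩ / √((2 : ℝ) ^ k) = ((2 : ℝ) ^ k)⁻¹ *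
      ((∫ y in rightHalf (𝒟.cell k x), f y) - ∫ y in leftHalf (𝒟.cell k x), f y) := by
    rw [haarCoeff, integral_mul_haar hI hint, volume_real_cell]
    nth_rw 3 [← Real.mul_self_sqrt hpos.le]
    field_simp
  have hsum : ∫ y in 𝒟.cell k x, f y =
      (∫ y in rightHalf (𝒟.cell k x), f y) + ∫ y in leftHalf (𝒟.cell k x), f y := by
    rw [← setIntegral_union disjoint_halves (measurableSet_leftHalf hI)
      (hint.mono_set Set.inter_subset_left) (hint.mono_set Set.inter_subset_left), halves_union]
  have habs : |𝒟.haarCoeff f ⟨𝒟.cell k x, cell_mem k x⟩| / √((2 : ℝ) ^ k) =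
      |𝒟.haarCoeff f ⟨𝒟.cell k x, cell_mem k x⟩ / √((2 : ℝ) ^ k)| := by
    rw [abs_div, abs_of_nonneg (Real.sqrt_nonneg _)]
  rw [habs, hcoeff, cellAverage_eq, cellAverage_eq, hsum, zpow_sub_one₀ two_ne_zero, mul_inv,
    inv_inv]
  -- The child is the left or the right half; the two cases differ by a sign, which the absolute
  -- value absorbs.
  rcases cell_ae_eq_half (𝒟 := 𝒟) k x with h | h
  · rw [setIntegral_congr_set h, ← abs_neg]
    ring_nf
  · rw [setIntegral_congr_set h]
    ring_nf

/-- Cauchy–Schwarz against the indicator of the cell. The decay is written as an integer power of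
`√2` to match `tendsto_zpow_atBot_zero_of_one_lt`. -/
theorem abs_cellAverage_le (f : Lp ℝ 2 (volume : Measure ℝ)) (k : ℤ) (x : ℝ) :
    |𝒟.cellAverage f k x| ≤ ((2 : ℝ) ^ (1 / 2 : ℝ)) ^ (-k) * ‖f‖ := by
  have hI : 𝒟.cell k x ∈ 𝒟.intervals := cell_mem k x
  have hpos : (0 : ℝ) < 2 ^ k := by positivity
  have h := abs_real_inner_le_norm
    (indicatorConstLp 2 (measurableSet_of_mem hI) (volume_ne_top hI) (1 : ℝ)) f
  rw [L2.inner_indicatorConstLp_one, norm_indicatorConstLp two_ne_zero ENNReal.ofNat_ne_top,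
    volume_real_cell, norm_one, one_mul] at h
  rw [cellAverage_eq, abs_mul, abs_of_pos (inv_pos.2 hpos)]
  calc _ ≤ ((2 : ℝ) ^ k)⁻¹ * (((2 : ℝ) ^ k) ^ (1 / (2 : ℝ≥0∞).toReal) * ‖f‖) := by gcongr
    _ = _ := by
      rw [← mul_assoc, ← Real.rpow_intCast, ← Real.rpow_intCast, ← Real.rpow_mul (by norm_num),
        ← Real.rpow_mul (by norm_num), ← Real.rpow_neg (by norm_num),
        ← Real.rpow_add (by norm_num), ENNReal.toReal_ofNat]
      push_cast
      ring_nf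

/-- Only decay in the length is used, so the cells around `x` need not exhaust `ℝ`; they may
increase to a half-line. -/
theorem tendsto_cellAverage_atTop (f : Lp ℝ 2 (volume : Measure ℝ)) (x : ℝ) :
    Filter.Tendsto (fun k => 𝒟.cellAverage f k x) Filter.atTop (nhds 0) := by
  refine squeeze_zero_norm (fun k => 𝒟.abs_cellAverage_le f k x) ?_
  have h := (tendsto_zpow_atBot_zero_of_one_lt (b := (2 : ℝ) ^ (1 / 2 : ℝ))
    (Real.one_lt_rpow (by norm_num) (by norm_num))).comp Filter.tendsto_neg_atTop_atBot
  simpa using h.mul_const ‖f‖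

/-- The Lebesgue differentiation theorem along the grid. -/
theorem ae_tendsto_cellAverage_atBot (f : Lp ℝ 2 (volume : Measure ℝ)) :
    ∀ᵐ x, Filter.Tendsto (fun k => 𝒟.cellAverage f k x) Filter.atBot (nhds (f x)) := by
  have hloc : LocallyIntegrable f volume := (Lp.memLp f).locallyIntegrable one_le_two
  filter_upwards [IsUnifLocDoublingMeasure.ae_tendsto_average volume hloc 1] with x hx
  -- Up to a null set a cell is a closed ball that contains `x` without being centred there, so
  -- differentiation along balls with moving centres applies.
  have hball : ∀ k : ℤ, Metric.closedBall (midpoint (𝒟.cell k x)) ((2 : ℝ) ^ k / 2) =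
      Set.Icc (sInf (𝒟.cell k x)) (sSup (𝒟.cell k x)) := fun k => by
    rw [Real.closedBall_eq_Icc, midpoint, ← volume_real_cell (𝒟 := 𝒟) k x,
      volume_real_eq_sub (cell_mem k x)]
    ring_nf
  have hδ : Filter.Tendsto (fun k : ℤ => (2 : ℝ) ^ k / 2) Filter.atBot
      (nhdsWithin 0 (Set.Ioi 0)) := by
    refine tendsto_nhdsWithin_iff.2 ⟨?_, Filter.Eventually.of_forall fun k => ?_⟩
    · simpa using (tendsto_zpow_atBot_zero_of_one_lt (b := (2 : ℝ)) (by norm_num)).div_const 2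
    · exact Set.mem_Ioi.2 (by positivity)
  have h := hx (fun k : ℤ => midpoint (𝒟.cell k x)) (fun k : ℤ => (2 : ℝ) ^ k / 2) hδ
    (Filter.Eventually.of_forall fun k => by
      rw [one_mul, hball]
      exact subset_Icc_of_mem (cell_mem k x) (mem_cell k x))
  refine h.congr fun k => ?_
  rw [hball, cellAverage, Measure.restrict_congr_set (ae_eq_Icc_of_mem (cell_mem k x))]

/-! ### The square function and the Sobolev inequality. -/

/-- The square of the dyadic square function of `D^s f`. -/
noncomputable def squareFunction (s : ℝ) (f : Lp ℝ 2 (volume : Measure ℝ)) (x : ℝ) : ℝ≥0∞ :=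
  ∑' I : 𝒟.intervals, (I : Set ℝ).indicator (fun _ => ENNReal.ofReal
    ((volume.real (I : Set ℝ) ^ (-s) * 𝒟.haarCoeff f I) ^ 2 / volume.real (I : Set ℝ))) x

theorem measurable_squareFunction (s : ℝ) (f : Lp ℝ 2 (volume : Measure ℝ)) :
    Measurable (𝒟.squareFunction s f) := by
  have := 𝒟.countable_intervals.to_subtype
  exact Measurable.tsum fun I => measurable_const.indicator (measurableSet_of_mem I.2)

/-- The factor `1 / |I|` normalises each indicator, so termwise integration leaves the sum of
squared coefficients, which is Parseval. -/
theorem lintegral_squareFunction {s : ℝ} {f : Lp ℝ 2 (volume : Measure ℝ)}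
    (hf : f ∈ 𝒟.sobolev s) :
    ∫⁻ x, 𝒟.squareFunction s f x = ENNReal.ofReal (𝒟.homSeminorm s f ^ 2) := by
  have := 𝒟.countable_intervals.to_subtype
  have hsum := 𝒟.hasSum_sq_homSeminorm hf
  unfold squareFunction
  rw [lintegral_tsum fun I =>
      (measurable_const.indicator (measurableSet_of_mem I.2)).aemeasurable,
    ← hsum.tsum_eq, ENNReal.ofReal_tsum_of_nonneg (fun I => sq_nonneg _) hsum.summable]
  refine tsum_congr fun I => ?_
  have hpos := volume_real_pos I.2
  rw [lintegral_indicator_const (measurableSet_of_mem I.2),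
    ← ENNReal.ofReal_toReal (volume_ne_top I.2), ← measureReal_def,
    ← ENNReal.ofReal_mul (by positivity), div_mul_cancel₀ _ hpos.ne']

theorem sq_div_le_squareFunction (s : ℝ) (f : Lp ℝ 2 (volume : Measure ℝ)) {x : ℝ}
    (hx : 𝒟.squareFunction s f x ≠ ∞) (I : 𝒟.intervals) (hxI : x ∈ (I : Set ℝ)) :
    (volume.real (I : Set ℝ) ^ (-s) * 𝒟.haarCoeff f I) ^ 2 / volume.real (I : Set ℝ) ≤
      (𝒟.squareFunction s f x).toReal := by
  refine (ENNReal.ofReal_le_iff_le_toReal hx).1 ?_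
  have := ENNReal.le_tsum (f := fun I : 𝒟.intervals => (I : Set ℝ).indicator (fun _ =>
    ENNReal.ofReal ((volume.real (I : Set ℝ) ^ (-s) * 𝒟.haarCoeff f I) ^ 2 /
      volume.real (I : Set ℝ))) x) I
  rwa [Set.indicator_of_mem hxI] at this

theorem abs_coeff_le_homSeminorm {s : ℝ} {f : Lp ℝ 2 (volume : Measure ℝ)}
    (hf : f ∈ 𝒟.sobolev s) (I : 𝒟.intervals) :
    |volume.real (I : Set ℝ) ^ (-s) * 𝒟.haarCoeff f I| ≤ 𝒟.homSeminorm s f :=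
  abs_le_of_sq_le_sq
    (le_hasSum (𝒟.hasSum_sq_homSeminorm hf) I fun _ _ => sq_nonneg _) (norm_nonneg _)

theorem ae_abs_le {s : ℝ} (hs0 : 0 < s) (hs1 : s < 1 / 2) {f : Lp ℝ 2 (volume : Measure ℝ)}
    (hf : f ∈ 𝒟.sobolev s) :
    ∀ᵐ x, |f x| ≤ dyadicSobolevConst s *
      (√(𝒟.squareFunction s f x).toReal ^ (1 - 2 * s) * 𝒟.homSeminorm s f ^ (2 * s)) := by
  -- Finiteness matters: `toReal` sends `∞` to `0`, which would void the pointwise bound.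
  have hfin : ∀ᵐ x, 𝒟.squareFunction s f x < ∞ :=
    ae_lt_top (𝒟.measurable_squareFunction s f)
      (by rw [𝒟.lintegral_squareFunction hf]; exact ENNReal.ofReal_ne_top)
  filter_upwards [𝒟.ae_tendsto_cellAverage_atBot f, hfin] with x hx hxfin
  have hcoeff (k : ℤ) : |𝒟.cellAverage f (k - 1) x - 𝒟.cellAverage f k x| =
      (2 : ℝ) ^ (k * s) * (|((2 : ℝ) ^ k) ^ (-s) *
        𝒟.haarCoeff f ⟨𝒟.cell k x, cell_mem k x⟩| / √((2 : ℝ) ^ k)) := by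
    have hpos : (0 : ℝ) < 2 ^ k := by positivity
    rw [abs_cellAverage_sub, abs_mul, abs_of_pos (Real.rpow_pos_of_pos hpos _), mul_div_assoc,
      ← mul_assoc, Real.rpow_mul (by norm_num), Real.rpow_intCast, ← Real.rpow_add hpos,
      add_neg_cancel, Real.rpow_zero, one_mul]
  refine abs_le_rpow_mul_rpow_of_increments_le hs0 hs1 (Real.sqrt_nonneg _) (norm_nonneg _)
    (fun k => ?_) (fun k => ?_) (𝒟.tendsto_cellAverage_atTop f x) hx
  · rw [hcoeff]
    refine mul_le_mul_of_nonneg_left (Real.le_sqrt_of_sq_le ?_) (by positivity)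
    have h := 𝒟.sq_div_le_squareFunction s f hxfin.ne ⟨𝒟.cell k x, cell_mem k x⟩ (mem_cell k x)
    rw [volume_real_cell] at h
    rwa [div_pow, sq_abs, Real.sq_sqrt (by positivity)]
  · rw [hcoeff]
    have h := 𝒟.abs_coeff_le_homSeminorm hf ⟨𝒟.cell k x, cell_mem k x⟩
    rw [volume_real_cell] at h
    have hsqrt : √((2 : ℝ) ^ k) = 2 ^ ((k : ℝ) * (1 / 2)) := by
      rw [Real.sqrt_eq_rpow, Real.rpow_mul (by norm_num), Real.rpow_intCast]
    rw [mul_sub, Real.rpow_sub (by norm_num), ← hsqrt, div_mul_eq_mul_div, mul_div_assoc]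
    gcongr

/-- The dyadic fractional Sobolev inequality. -/
theorem eLpNorm_le_homSeminorm {s : ℝ} (hs0 : 0 < s) (hs1 : s < 1 / 2)
    {f : Lp ℝ 2 (volume : Measure ℝ)} (hf : f ∈ 𝒟.sobolev s) :
    eLpNorm f (ENNReal.ofReal (2 / (1 - 2 * s))) volume ≤
      ENNReal.ofReal (dyadicSobolevConst s * 𝒟.homSeminorm s f) := by
  have hd : 0 < 1 - 2 * s := by linarith
  set q : ℝ := 2 / (1 - 2 * s) with hq
  have hq0 : 0 < q := by positivity
  -- This identity fixes `q`: it turns the power of the square root into the square function itself.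
  have hq2 : (1 - 2 * s) * q = 2 := by rw [hq]; field_simp
  have hC := (dyadicSobolevConst_pos hs0 hs1).le
  have hG : 0 ≤ 𝒟.homSeminorm s f := norm_nonneg _
  rw [eLpNorm_eq_lintegral_rpow_enorm_toReal (by simpa using hq0) ENNReal.ofReal_ne_top,
    ENNReal.toReal_ofReal hq0.le]
  have hbound : ∫⁻ x, ‖f x‖ₑ ^ q ≤
      ENNReal.ofReal (dyadicSobolevConst s * 𝒟.homSeminorm s f) ^ q := by
    calc ∫⁻ x, ‖f x‖ₑ ^ q
        ≤ ∫⁻ x, ENNReal.ofReal (dyadicSobolevConst s ^ q * 𝒟.homSeminorm s f ^ (2 * s * q)) *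
            𝒟.squareFunction s f x := by
          refine lintegral_mono_ae ?_
          filter_upwards [𝒟.ae_abs_le hs0 hs1 hf] with x hx
          rw [← ofReal_norm, ENNReal.ofReal_rpow_of_nonneg (norm_nonneg _) hq0.le,
            Real.norm_eq_abs]
          refine le_trans (ENNReal.ofReal_le_ofReal ?_)
            ((ENNReal.ofReal_mul (by positivity)).trans_le
              (mul_le_mul_right (ENNReal.ofReal_toReal_le (a := 𝒟.squareFunction s f x)) _))
          refine (Real.rpow_le_rpow (abs_nonneg _) hx hq0.le).trans_eq ?_
          rw [Real.mul_rpow hC (by positivity), Real.mul_rpow (by positivity) (by positivity),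
            ← Real.rpow_mul (by positivity), ← Real.rpow_mul hG, hq2, Real.rpow_two,
            Real.sq_sqrt ENNReal.toReal_nonneg]
          ring
      _ = ENNReal.ofReal (dyadicSobolevConst s ^ q * 𝒟.homSeminorm s f ^ (2 * s * q)) *
            ENNReal.ofReal (𝒟.homSeminorm s f ^ 2) := by
          rw [lintegral_const_mul _ (𝒟.measurable_squareFunction s f),
            𝒟.lintegral_squareFunction hf]
      _ = _ := by
          rw [← ENNReal.ofReal_mul (by positivity),
            ENNReal.ofReal_rpow_of_nonneg (by positivity) hq0.le, Real.mul_rpow hC hG, mul_assoc,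
            ← Real.rpow_natCast, ← Real.rpow_add_of_nonneg hG (by positivity) (by positivity)]
          -- The powers of the seminorm match because `2sq + 2 = q`, again by `hq2`.
          congr 4
          push_cast
          linarith
  calc (∫⁻ x, ‖f x‖ₑ ^ q) ^ (1 / q)
      ≤ (ENNReal.ofReal (dyadicSobolevConst s * 𝒟.homSeminorm s f) ^ q) ^ (1 / q) := by gcongr
    _ = _ := by rw [← ENNReal.rpow_mul, mul_one_div_cancel hq0.ne', ENNReal.rpow_one]

end DyadicGrid

theorem mainTheorem3 (s : ℝ) (hs0 : 0 < s) (hs1 : s < 1 / 2) :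
    ∃ C : ℝ, 0 < C ∧ ∀ 𝒟 : DyadicGrid,
      (∀ f ∈ 𝒟.haarSpan, f ∈ 𝒟.sobolev s ∧
        eLpNorm f (ENNReal.ofReal (2 / (1 - 2 * s))) volume
          ≤ ENNReal.ofReal (C * 𝒟.homSeminorm s f)) ∧
      (∀ f ∈ 𝒟.sobolev s,
        MemLp f (ENNReal.ofReal (2 / (1 - 2 * s))) volume ∧
        eLpNorm f (ENNReal.ofReal (2 / (1 - 2 * s))) volume
          ≤ ENNReal.ofReal (C * 𝒟.homSeminorm s f)) := by
  refine ⟨dyadicSobolevConst s, dyadicSobolevConst_pos hs0 hs1, fun 𝒟 =>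
    ⟨fun f hf => ?_, fun f hf => ?_⟩⟩
  · have hf' := 𝒟.haarSpan_subset_sobolev s hf
    exact ⟨hf', 𝒟.eLpNorm_le_homSeminorm hs0 hs1 hf'⟩
  · have h := 𝒟.eLpNorm_le_homSeminorm hs0 hs1 hf
    exact ⟨⟨Lp.aestronglyMeasurable f, h.trans_lt ENNReal.ofReal_lt_top⟩, h⟩
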